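/- For an integer $K\ge 0$, integers $0\le r,s\le K$ and an integer $n\ge 0$, let $C_n^{(K)}(r\to s)$ be the number of lattice paths with steps $(1,1)$ and $(1,-1)$ from $(0,r)$ to $(n,s)$ that never pass below the $x$-axis and never pass above the line $y=K$. For odd $K$, the sequence $\big(C_n^{(K)}(r\to s)\big)_{n\ge 0}$ has a unique extension to all $n\in\mathbb{Z}$ that satisfies a linear recurrence with constant coefficients $c_0\,C_n^{(K)}(r\to s)+c_1\,C_{n+1}^{(K)}(r\to s)+\dots+c_d\,C_{n+d}^{(K)}(r\to s)=0$ with $c_0\neq 0$ for all $n\in\mathbb{Z}$; this defines $C_n^{(K)}(r\to s)$ for negative $n$. For odd $K$ and every even integer $t$ (positive, zero or negative), put $$D_{t}^{(K)}:=C_{t+K}^{(K)}(0\to K).$$ **Theorem.** For all non-negative integers $n$ and all positive integers $k,m$, we have $$ \det\left(D_{2n+2j-2i}^{(2k+2m-1)}\right)_{0\le i,j\le k-1} = (-1)^{km}\det\left(D_{-2n-2j+2i-2k-2m}^{(2k+2m-1)}\right)_{0\le i,j\le m-1}. $$ -/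

import Mathlib

/-- An up-down path with `n` steps inside the strip `0 ≤ y ≤ K`, given by its sequence of heights
`p 0, p 1, …, p n`: each step changes the height by `+1` or by `-1`. -/
def IsUpDownPath {K n : ℕ} (p : Fin (n + 1) → Fin (K + 1)) : Prop :=
  ∀ i : Fin n, (p i.succ : ℕ) = p i.castSucc + 1 ∨ (p i.castSucc : ℕ) = p i.succ + 1

/-- The number `C_n^{(K)}(r → s)` of up-down paths from `(0, r)` to `(n, s)` that do not pass below
the `x`-axis and do not pass above the line `y = K`, for `n ≥ 0`. -/
noncomputable def pathCount (K : ℕ) (r s : Fin (K + 1)) (n : ℕ) : ℕ :=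
  Nat.card {p : Fin (n + 1) → Fin (K + 1) // p 0 = r ∧ p (Fin.last n) = s ∧ IsUpDownPath p}

/-- The two-sided sequence `b` extends `a` to negative indices by applying a linear recurrence with
constant coefficients backwards: `b` agrees with `a` on the non-negative integers, and `b` satisfies
on all of `ℤ` a recurrence `c₀ b(n) + c₁ b(n+1) + ⋯ + c_d b(n+d) = 0` with `c₀ ≠ 0`. -/
def IsRecurrenceExtension (a : ℕ → ℚ) (b : ℤ → ℚ) : Prop :=
  (∀ n : ℕ, b n = a n) ∧
    ∃ (d : ℕ) (c : ℕ → ℚ), c 0 ≠ 0 ∧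
      ∀ n : ℤ, ∑ i ∈ Finset.range (d + 1), c i * b (n + i) = 0

/-- Such an extension is unique: it depends neither on a choice nor on the recurrence used. -/
theorem IsRecurrenceExtension.unique {a : ℕ → ℚ} {b b' : ℤ → ℚ}
    (hb : IsRecurrenceExtension a b) (hb' : IsRecurrenceExtension a b') : b = b' := by
  obtain ⟨h0, d, c, hc, h⟩ := hb
  obtain ⟨h0', d', c', hc', h'⟩ := hb'
  have key : ∀ n : ℤ, ∑ i ∈ Finset.range (d + 1), ∑ j ∈ Finset.range (d' + 1),
      c i * c' j * (b (n + i + j) - b' (n + i + j)) = 0 := by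
    intro n
    simp only [mul_sub, Finset.sum_sub_distrib]
    have e1 : ∑ i ∈ Finset.range (d + 1), ∑ j ∈ Finset.range (d' + 1),
        c i * c' j * b (n + i + j) = 0 := by
      rw [Finset.sum_comm]
      refine Finset.sum_eq_zero fun j _ => ?_
      have := h (n + j)
      calc _ = c' j * ∑ i ∈ Finset.range (d + 1), c i * b (n + j + i) := by
            rw [Finset.mul_sum]
            refine Finset.sum_congr rfl fun i _ => ?_
            rw [add_right_comm n (i : ℤ) (j : ℤ)]; ring
        _ = 0 := by rw [this, mul_zero]
    have e2 : ∑ i ∈ Finset.range (d + 1), ∑ j ∈ Finset.range (d' + 1),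
        c i * c' j * b' (n + i + j) = 0 := by
      refine Finset.sum_eq_zero fun i _ => ?_
      have := h' (n + i)
      calc _ = c i * ∑ j ∈ Finset.range (d' + 1), c' j * b' (n + i + j) := by
            rw [Finset.mul_sum]
            refine Finset.sum_congr rfl fun j _ => ?_
            ring
        _ = 0 := by rw [this, mul_zero]
    rw [e1, e2, sub_zero]
  have main : ∀ N : ℕ, ∀ n : ℤ, -(N : ℤ) ≤ n → b n - b' n = 0 := by
    intro N
    induction N with
    | zero =>
      intro n hn
      lift n to ℕ using by simpa using hn
      rw [h0, h0', sub_self]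
    | succ N ih =>
      intro n hn
      by_cases hlt : -(N : ℤ) ≤ n
      · exact ih n hlt
      have hk := key n
      have hpos : ∀ i j : ℕ, 0 < i + j → b (n + i + j) - b' (n + i + j) = 0 := by
        intro i j hij
        apply ih
        push_cast at hn
        omega
      rw [Finset.sum_eq_single_of_mem 0 (by simp), Finset.sum_eq_single_of_mem 0 (by simp)] at hk
      · simpa [hc, hc'] using hk
      · intro j _ hj
        rw [hpos 0 j (by omega), mul_zero]
      · intro i _ hi
        refine Finset.sum_eq_zero fun j _ => ?_
        rw [hpos i j (by omega), mul_zero]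
  funext n
  exact sub_eq_zero.mp (main n.natAbs n (by omega))

open Classical in
/-- The extension of `a` to all of `ℤ` by running its linear recurrence backwards
(and `0` for a sequence that has no such extension). -/
noncomputable def recurrenceExtension (a : ℕ → ℚ) : ℤ → ℚ :=
  if h : ∃ b : ℤ → ℚ, IsRecurrenceExtension a b then h.choose else 0

/-- The number `C_n^{(K)}(r → s)` for arbitrary `n ∈ ℤ`. -/
noncomputable def extPathCount (K : ℕ) (r s : Fin (K + 1)) : ℤ → ℚ :=
  recurrenceExtension fun n : ℕ => (pathCount K r s n : ℚ)

/-- `D_t^{(K)} = C_{t+K}^{(K)}(0 → K)` (used for even `t ∈ ℤ`). -/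
noncomputable def topPathCount (K : ℕ) (t : ℤ) : ℚ :=
  extPathCount K 0 (Fin.last K) (t + K)

/-- The transfer matrix of one step in the strip `0 ≤ y ≤ K`. -/
def stepMatrix (K : ℕ) : Matrix (Fin (K + 1)) (Fin (K + 1)) ℚ :=
  Matrix.of fun x y => if (y : ℕ) = x + 1 ∨ (x : ℕ) = y + 1 then 1 else 0

theorem pathCount_eq_pow (K : ℕ) (r s : Fin (K + 1)) (n : ℕ) :
    (pathCount K r s n : ℚ) = (stepMatrix K ^ n) r s := by
  classical
  induction n generalizing r with
  | zero =>
    have hs : ∀ r s : Fin (K + 1), (pathCount K r s 0 : ℚ) = if r = s then 1 else 0 := by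
      intro r s
      unfold pathCount
      split_ifs with h
      · subst h
        have : Unique {p : Fin (0 + 1) → Fin (K + 1) //
            p 0 = r ∧ p (Fin.last 0) = r ∧ IsUpDownPath p} :=
          { default := ⟨fun _ => r, rfl, rfl, fun i => i.elim0⟩
            uniq := by
              rintro ⟨p, hp, -, -⟩
              apply Subtype.ext
              funext i
              have hi : i = 0 := Fin.ext (by omega)
              rw [hi]
              exact hp }
        rw [Nat.card_unique, Nat.cast_one]
      · have : IsEmpty {p : Fin (0 + 1) → Fin (K + 1) //
            p 0 = r ∧ p (Fin.last 0) = s ∧ IsUpDownPath p} :=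
          ⟨fun ⟨p, hp, hq, _⟩ => h (hp.symm.trans hq)⟩
        rw [Nat.card_of_isEmpty, Nat.cast_zero]
    rw [hs, pow_zero, Matrix.one_apply]
  | succ n ih =>
    rw [pow_succ', Matrix.mul_apply]
    simp only [← ih]
    let e : {p : Fin (n + 1 + 1) → Fin (K + 1) //
        p 0 = r ∧ p (Fin.last (n + 1)) = s ∧ IsUpDownPath p} ≃
        Σ t : Fin (K + 1), {p : Fin (n + 1) → Fin (K + 1) //
          ((t : ℕ) = r + 1 ∨ (r : ℕ) = t + 1) ∧
            (p 0 = t ∧ p (Fin.last n) = s ∧ IsUpDownPath p)} :=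
      { toFun := fun p => ⟨p.1 1, Fin.tail p.1, by
            have := p.2.2.2 0
            rwa [Fin.castSucc_zero, p.2.1] at this, rfl, p.2.2.1,
            fun i => p.2.2.2 i.succ⟩
        invFun := fun q => ⟨Fin.cons r q.2.1, rfl, q.2.2.2.2.1, by
            intro i
            refine Fin.cases ?_ (fun i => ?_) i
            · have := q.2.2.1
              rw [← q.2.2.2.1] at this
              exact this
            · exact q.2.2.2.2.2 i⟩
        left_inv := by
          rintro ⟨p, rfl, h⟩
          apply Subtype.ext
          exact Fin.cons_self_tail p
        right_inv := by
          rintro ⟨t, p, h, rfl, h'⟩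
          rfl }
    unfold pathCount
    rw [Nat.card_congr e, Nat.card_sigma]
    push_cast
    refine Finset.sum_congr rfl fun t _ => ?_
    by_cases h : (t : ℕ) = r + 1 ∨ (r : ℕ) = t + 1
    · simp [stepMatrix, h]
    · simp [stepMatrix, h]

theorem stepMatrix_det_ne_zero {K : ℕ} (hK : Odd K) : (stepMatrix K).det ≠ 0 := by
  intro h
  obtain ⟨v, hv, h0⟩ := Matrix.exists_mulVec_eq_zero_iff.mpr h
  apply hv
  obtain ⟨l, rfl⟩ := hK
  let w : ℕ → ℚ := fun i => if h : i < 2 * l + 1 + 1 then v ⟨i, h⟩ else 0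
  have hw : ∀ i : Fin (2 * l + 1 + 1), v i = w i := fun i => by
    simp only [w, dif_pos i.2]
  have row : ∀ i, i < 2 * l + 1 + 1 → w (i + 1) + (if i = 0 then 0 else w (i - 1)) = 0 := by
    intro i hi
    have := congrFun h0 ⟨i, hi⟩
    simp only [Matrix.mulVec, dotProduct, stepMatrix, Matrix.of_apply, Pi.zero_apply, hw] at this
    rw [Fin.sum_univ_eq_sum_range
      (fun y => (if y = i + 1 ∨ i = y + 1 then (1 : ℚ) else 0) * w y)] at this
    refine Eq.trans ?_ this
    have split : ∀ y, (if y = i + 1 ∨ i = y + 1 then (1 : ℚ) else 0) * w y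
        = (if y = i + 1 then w y else 0) + (if i = y + 1 then w y else 0) := by
      intro y
      by_cases h1 : y = i + 1
      · subst h1
        rw [if_pos (Or.inl rfl), if_pos rfl, if_neg (by omega)]; ring
      · rw [if_neg h1, zero_add]
        by_cases h2 : i = y + 1
        · rw [if_pos (Or.inr h2), if_pos h2, one_mul]
        · rw [if_neg (by omega), if_neg h2, zero_mul]
    simp only [split, Finset.sum_add_distrib]
    congr 1
    · rw [Finset.sum_ite_eq']
      by_cases h3 : i + 1 < 2 * l + 1 + 1
      · rw [if_pos (Finset.mem_range.mpr h3)]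
      · rw [if_neg (by simpa using h3)]
        simp only [w, dif_neg h3]
    · by_cases h3 : i = 0
      · subst h3; simp
      · rw [if_neg h3, Finset.sum_eq_single_of_mem (i - 1) (by simp; omega)]
        · rw [if_pos (by omega)]
        · intro b _ hb
          rw [if_neg (by omega)]
  have odd : ∀ j, j ≤ l → w (2 * j + 1) = 0 := by
    intro j
    induction j with
    | zero => intro _; simpa using row 0 (by omega)
    | succ j ih =>
      intro hj
      have := row (2 * j + 2) (by omega)
      rw [if_neg (by omega), show 2 * j + 2 - 1 = 2 * j + 1 by omega, ih (by omega),
        add_zero] at this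
      exact this
  have even : ∀ j, j ≤ l → w (2 * (l - j)) = 0 := by
    intro j
    induction j with
    | zero =>
      intro _
      have := row (2 * l + 1) (by omega)
      have h2 : w (2 * l + 1 + 1) = 0 := by simp [w]
      rw [if_neg (by omega), h2, zero_add] at this
      exact this
    | succ j ih =>
      intro hj
      have := row (2 * (l - (j + 1)) + 1) (by omega)
      rw [if_neg (by omega), show 2 * (l - (j + 1)) + 1 + 1 = 2 * (l - j) by omega,
        ih (by omega), zero_add] at this
      exact this
  funext i
  rw [hw, Pi.zero_apply]
  obtain ⟨i, hi⟩ := i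
  rcases Nat.even_or_odd' i with ⟨c, rfl | rfl⟩
  · have := even (l - c) (by omega)
    rwa [show l - (l - c) = c by omega] at this
  · exact odd c (by omega)

/-- For an odd bound `K` the extension to negative lengths exists. -/
theorem exists_isRecurrenceExtension_pathCount {K : ℕ} (hK : Odd K) (r s : Fin (K + 1)) :
    ∃ b : ℤ → ℚ, IsRecurrenceExtension (fun n : ℕ => (pathCount K r s n : ℚ)) b := by
  have hdet : IsUnit (stepMatrix K).det := (stepMatrix_det_ne_zero hK).isUnit
  refine ⟨fun n => (stepMatrix K ^ n) r s, fun n => ?_,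
    (stepMatrix K).charpoly.natDegree, (stepMatrix K).charpoly.coeff, ?_, fun n => ?_⟩
  · simp only [zpow_natCast, pathCount_eq_pow]
  · intro h
    apply stepMatrix_det_ne_zero hK
    rw [Matrix.det_eq_sign_charpoly_coeff, h, mul_zero]
  · have hCH := Matrix.aeval_self_charpoly (stepMatrix K)
    rw [Polynomial.aeval_eq_sum_range] at hCH
    have h2 := congrArg (fun M => (stepMatrix K ^ n * M) r s) hCH
    simp only [Finset.mul_sum, mul_zero, Matrix.zero_apply, Matrix.sum_apply] at h2
    rw [← h2]
    refine Finset.sum_congr rfl fun i _ => ?_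
    beta_reduce
    rw [Matrix.zpow_add hdet, zpow_natCast, Matrix.mul_smul, Matrix.smul_apply, smul_eq_mul]

/-- For an odd bound `K`, the numbers `extPathCount K r s` are the extension of the path counts. -/
theorem extPathCount_spec {K : ℕ} (hK : Odd K) (r s : Fin (K + 1)) :
    IsRecurrenceExtension (fun n : ℕ => (pathCount K r s n : ℚ)) (extPathCount K r s) := by
  have h := exists_isRecurrenceExtension_pathCount hK r s
  rw [extPathCount, recurrenceExtension, dif_pos h]
  exact h.choose_spec

/-!
Write `L = k + m`, `K = 2 * L - 1`, `T = stepMatrix K` and `h t = D_{2t} = (T ^ (2 t + K)) 0 K` for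
`t : ℤ` (`topPathCount_eq_zpow`). Both sides of the theorem are minors of the bi-infinite Toeplitz
matrix of `h`, and three facts about `h` relate them.

* `h 0 = 1`, `h (-j) = 0` for `0 < j < L`, and `h (-L) = (-1) ^ (L - 1)`. The first two count paths
  of length at most `K` from height `0` to height `K`; the third is a corner entry of `T⁻¹`.
* Put `v t = (h (t - i))_{0 ≤ i < L}`. The determinant of `L` of these vectors does not change if
  all their indices are shifted by the same integer (`det_window_shift`). For, `v t` is the image
  under a fixed matrix of the column of `T ^ (2 t)` at height `K`, restricted to the odd heights,
  and `T ^ 2` acts on the odd heights with determinant one: it is the product of the odd-even and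
  the even-odd block of `T`, which are unitriangular.
* The determinant of `v n, …, v (n + k - 1), v (-m), …, v (-1)` is block triangular, and so is, up to
  a permutation of the rows, that of the same vectors with indices shifted by `-(n + k)`. Expanding
  both gives the left minor and the right minor of the theorem, with the same factor for every `n`.

The factor, which includes the sign of the row permutation, is found by putting `n = 0`, where both
minors are triangular (`det_toeplitz_eq`).
-/

/-! ### Powers of the transfer matrix -/

theorem extPathCount_eq_zpow {K : ℕ} (hK : Odd K) (r s : Fin (K + 1)) (n : ℤ) :
    extPathCount K r s n = (stepMatrix K ^ n) r s := by
  have hdet : IsUnit (stepMatrix K).det := (stepMatrix_det_ne_zero hK).isUnit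
  refine congrFun ((extPathCount_spec hK r s).unique
    (b' := fun n => (stepMatrix K ^ n) r s) ⟨fun n => ?_,
    (stepMatrix K).charpoly.natDegree, (stepMatrix K).charpoly.coeff, ?_, fun n => ?_⟩) n
  · simp only [zpow_natCast, pathCount_eq_pow]
  · intro h
    apply stepMatrix_det_ne_zero hK
    rw [Matrix.det_eq_sign_charpoly_coeff, h, mul_zero]
  · have hCH := Matrix.aeval_self_charpoly (stepMatrix K)
    rw [Polynomial.aeval_eq_sum_range] at hCH
    have h2 := congrArg (fun M => (stepMatrix K ^ n * M) r s) hCH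
    simp only [Finset.mul_sum, mul_zero, Matrix.zero_apply, Matrix.sum_apply] at h2
    rw [← h2]
    refine Finset.sum_congr rfl fun i _ => ?_
    beta_reduce
    rw [Matrix.zpow_add hdet, zpow_natCast, Matrix.mul_smul, Matrix.smul_apply, smul_eq_mul]

theorem topPathCount_eq_zpow {K : ℕ} (hK : Odd K) (t : ℤ) :
    topPathCount K t = (stepMatrix K ^ (t + K)) 0 (Fin.last K) :=
  extPathCount_eq_zpow hK _ _ _

theorem stepMatrix_apply (K : ℕ) (x y : Fin (K + 1)) :
    stepMatrix K x y = if (y : ℕ) = x + 1 ∨ (x : ℕ) = y + 1 then 1 else 0 := rfl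

theorem stepMatrix_pow_apply_eq_zero_of_parity (K n : ℕ) (x y : Fin (K + 1))
    (h : Odd (n + x + y : ℕ)) : (stepMatrix K ^ n) x y = 0 := by
  induction n generalizing x with
  | zero =>
    rw [pow_zero, Matrix.one_apply_ne]
    rintro rfl
    rw [Nat.odd_iff] at h
    omega
  | succ n ih =>
    rw [pow_succ', Matrix.mul_apply]
    refine Finset.sum_eq_zero fun z _ => ?_
    rw [stepMatrix_apply]
    split_ifs with hz
    · rw [ih z, mul_zero]
      rw [Nat.odd_iff] at h ⊢
      omega
    · rw [zero_mul]

theorem stepMatrix_pow_apply_eq_zero_of_lt (K n : ℕ) (x y : Fin (K + 1))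
    (h : (x : ℕ) + n < y) : (stepMatrix K ^ n) x y = 0 := by
  induction n generalizing x with
  | zero =>
    rw [pow_zero, Matrix.one_apply_ne]
    rintro rfl
    omega
  | succ n ih =>
    rw [pow_succ', Matrix.mul_apply]
    refine Finset.sum_eq_zero fun z _ => ?_
    rw [stepMatrix_apply]
    split_ifs with hz
    · rw [ih z (by omega), mul_zero]
    · rw [zero_mul]

theorem stepMatrix_pow_apply_eq_one (K n : ℕ) (x y : Fin (K + 1))
    (h : (x : ℕ) + n = y) : (stepMatrix K ^ n) x y = 1 := by
  induction n generalizing x with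
  | zero =>
    have : x = y := Fin.ext (by omega)
    rw [this, pow_zero, Matrix.one_apply_eq]
  | succ n ih =>
    rw [pow_succ', Matrix.mul_apply, Finset.sum_eq_single ⟨x + 1, by omega⟩]
    · rw [ih _ (by simp; omega), stepMatrix_apply]
      simp
    · intro z _ hz
      rw [stepMatrix_apply]
      split_ifs with hz'
      · rw [stepMatrix_pow_apply_eq_zero_of_lt, mul_zero]
        have : (z : ℕ) ≠ x + 1 := fun h' => hz (Fin.ext h')
        omega
      · rw [zero_mul]
    · simp

/-! ### Even and odd heights -/

/-- The even height `2 * a` in a strip with `2 * L` heights. -/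
def evenHeight {K L : ℕ} (hK : K + 1 = 2 * L) (a : Fin L) : Fin (K + 1) := ⟨2 * a, by omega⟩

/-- The odd height `2 * a + 1` in a strip with `2 * L` heights. -/
def oddHeight {K L : ℕ} (hK : K + 1 = 2 * L) (a : Fin L) : Fin (K + 1) := ⟨2 * a + 1, by omega⟩

theorem sum_eq_even_add_odd {K L : ℕ} (hK : K + 1 = 2 * L) (f : Fin (K + 1) → ℚ) :
    ∑ y, f y = ∑ a, f (evenHeight hK a) + ∑ a, f (oddHeight hK a) := by
  have hb : Function.Bijective (Sum.elim (evenHeight hK) (oddHeight hK)) := by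
    constructor
    · rintro (a | a) (b | b) h <;>
        simp only [Sum.elim_inl, Sum.elim_inr, evenHeight, oddHeight, Fin.mk.injEq] at h
      · exact congrArg _ (Fin.ext (by omega))
      · omega
      · omega
      · exact congrArg _ (Fin.ext (by omega))
    · intro y
      rcases Nat.even_or_odd' (y : ℕ) with ⟨c, hc | hc⟩
      · exact ⟨Sum.inl ⟨c, by omega⟩, Fin.ext hc.symm⟩
      · exact ⟨Sum.inr ⟨c, by omega⟩, Fin.ext hc.symm⟩
  rw [← hb.sum_comp f, Fintype.sum_sum_type]
  rfl

/-- The block of the transfer matrix with odd row heights and even column heights. -/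
def oddEvenBlock {K L : ℕ} (hK : K + 1 = 2 * L) : Matrix (Fin L) (Fin L) ℚ :=
  (stepMatrix K).submatrix (oddHeight hK) (evenHeight hK)

/-- The block of the transfer matrix with even row heights and odd column heights. -/
def evenOddBlock {K L : ℕ} (hK : K + 1 = 2 * L) : Matrix (Fin L) (Fin L) ℚ :=
  (stepMatrix K).submatrix (evenHeight hK) (oddHeight hK)

theorem det_oddEvenBlock {K L : ℕ} (hK : K + 1 = 2 * L) : (oddEvenBlock hK).det = 1 := by
  rw [Matrix.det_of_isUpperTriangular]
  · refine Finset.prod_eq_one fun a _ => ?_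
    simp [oddEvenBlock, stepMatrix_apply, oddHeight, evenHeight]
  · intro a b (hab : b < a)
    simp only [oddEvenBlock, stepMatrix_apply, oddHeight, evenHeight, Matrix.submatrix_apply]
    exact if_neg (by omega)

theorem det_evenOddBlock {K L : ℕ} (hK : K + 1 = 2 * L) : (evenOddBlock hK).det = 1 := by
  rw [← det_oddEvenBlock hK, ← Matrix.det_transpose]
  congr 1
  ext a b
  simp only [oddEvenBlock, evenOddBlock, stepMatrix_apply, Matrix.transpose_apply,
    Matrix.submatrix_apply]
  exact if_congr or_comm rfl rfl

theorem stepMatrix_odd_odd {K L : ℕ} (hK : K + 1 = 2 * L) (a b : Fin L) :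
    stepMatrix K (oddHeight hK a) (oddHeight hK b) = 0 := by
  simp only [stepMatrix_apply, oddHeight]
  exact if_neg (by omega)

theorem stepMatrix_even_even {K L : ℕ} (hK : K + 1 = 2 * L) (a b : Fin L) :
    stepMatrix K (evenHeight hK a) (evenHeight hK b) = 0 := by
  simp only [stepMatrix_apply, evenHeight]
  exact if_neg (by omega)

theorem isUnit_det_stepMatrix {K L : ℕ} (hK : K + 1 = 2 * L) : IsUnit (stepMatrix K).det :=
  (stepMatrix_det_ne_zero (Nat.odd_iff.mpr (by omega))).isUnit

/-- Two steps from an odd height: to an even height, and back to an odd one. -/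
theorem stepMatrix_zpow_add_two_odd {K L : ℕ} (hK : K + 1 = 2 * L) (t : ℤ) (y : Fin (K + 1))
    (a : Fin L) : (stepMatrix K ^ (t + 2)) (oddHeight hK a) y =
      ∑ b, (oddEvenBlock hK * evenOddBlock hK) a b * (stepMatrix K ^ t) (oddHeight hK b) y := by
  have step : ∀ (s : ℤ) (x : Fin (K + 1)), (stepMatrix K ^ (s + 1)) x y =
      ∑ z, stepMatrix K x z * (stepMatrix K ^ s) z y := fun s x => by
    rw [add_comm s 1, Matrix.zpow_add (isUnit_det_stepMatrix hK), zpow_one, Matrix.mul_apply]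
  rw [show t + 2 = t + 1 + 1 by ring, step, sum_eq_even_add_odd hK]
  simp only [stepMatrix_odd_odd, zero_mul, Finset.sum_const_zero, add_zero]
  simp only [step, sum_eq_even_add_odd hK, stepMatrix_even_even, zero_mul, Finset.sum_const_zero,
    zero_add, Matrix.mul_apply, Finset.sum_mul, Finset.mul_sum]
  rw [Finset.sum_comm]
  simp only [oddEvenBlock, evenOddBlock, Matrix.submatrix_apply, mul_assoc]

/-! ### The sequence of top path counts at even arguments -/

/-- The sequence `h t = D_{2t}`. -/
noncomputable def evenTopCount (K : ℕ) (t : ℤ) : ℚ := topPathCount K (2 * t)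

theorem evenTopCount_eq_zpow {K L : ℕ} (hK : K + 1 = 2 * L) (t : ℤ) :
    evenTopCount K t = (stepMatrix K ^ (2 * t + K)) 0 (Fin.last K) :=
  topPathCount_eq_zpow (Nat.odd_iff.mpr (by omega)) _

theorem evenTopCount_zero {K L : ℕ} (hK : K + 1 = 2 * L) : evenTopCount K 0 = 1 := by
  rw [evenTopCount_eq_zpow hK, mul_zero, zero_add, zpow_natCast]
  exact stepMatrix_pow_apply_eq_one _ _ _ _ (by simp)

theorem evenTopCount_eq_zero {K L : ℕ} (hK : K + 1 = 2 * L) {t : ℤ} (h : -(L : ℤ) < t)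
    (h' : t < 0) : evenTopCount K t = 0 := by
  obtain ⟨p, hp⟩ : ∃ p : ℕ, 2 * t + K = p := ⟨(2 * t + K).toNat, by omega⟩
  rw [evenTopCount_eq_zpow hK, hp, zpow_natCast]
  exact stepMatrix_pow_apply_eq_zero_of_lt _ _ _ _ (by simp; omega)

/-- The corner entry of the inverse transfer matrix, read off from the solution of `T x = e_K`:
it vanishes at odd heights and alternates in sign along the even heights. -/
theorem evenTopCount_neg {K L : ℕ} (hK : K + 1 = 2 * L) :
    evenTopCount K (-L) = (-1) ^ (L - 1) := by
  have hL : 0 < L := by omega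
  have key : ∀ j, j < L → ∀ a : Fin L, (a : ℕ) + j = L - 1 →
      (stepMatrix K ^ (-1 : ℤ)) (evenHeight hK a) (Fin.last K) = (-1) ^ j := by
    have row : ∀ a : Fin L, ∑ b, oddEvenBlock hK a b *
        (stepMatrix K ^ (-1 : ℤ)) (evenHeight hK b) (Fin.last K) =
          if (a : ℕ) = L - 1 then 1 else 0 := by
      intro a
      have h1 := congrFun (congrFun (Matrix.mul_nonsing_inv _ (isUnit_det_stepMatrix hK))
        (oddHeight hK a)) (Fin.last K)
      rw [Matrix.mul_apply, sum_eq_even_add_odd hK] at h1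
      simp only [stepMatrix_odd_odd, zero_mul, Finset.sum_const_zero, add_zero] at h1
      rw [Matrix.zpow_neg_one]
      refine h1.trans ?_
      rw [Matrix.one_apply]
      refine if_congr ?_ rfl rfl
      simp only [Fin.ext_iff, oddHeight, Fin.val_last]
      omega
    have block : ∀ a b : Fin L, oddEvenBlock hK a b =
        if b = a ∨ (b : ℕ) = a + 1 then 1 else 0 := by
      intro a b
      simp only [oddEvenBlock, stepMatrix_apply, Matrix.submatrix_apply, oddHeight, evenHeight]
      refine if_congr ?_ rfl rfl
      rw [Fin.ext_iff]
      omega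
    intro j
    induction j with
    | zero =>
      intro _ a ha
      have h1 := row a
      rw [Finset.sum_eq_single a, block, if_pos (Or.inl rfl), if_pos (by omega), one_mul] at h1
      · rw [h1, pow_zero]
      · intro b _ hb
        rw [block, if_neg (by rintro (h | h) <;> [exact hb h; omega]), zero_mul]
      · simp
    | succ j ih =>
      intro hj a ha
      have h1 := row a
      have hne : a ≠ ⟨a + 1, by omega⟩ := by simp [Fin.ext_iff]
      rw [Fintype.sum_eq_add a ⟨a + 1, by omega⟩ hne, block, block, if_pos (Or.inl rfl),
        if_pos (Or.inr rfl), one_mul, one_mul, if_neg (by omega),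
        ih (by omega) ⟨a + 1, by omega⟩ (show (a : ℕ) + 1 + j = L - 1 by omega)] at h1
      · rw [pow_succ]
        linarith
      · intro b hb
        rw [block, if_neg, zero_mul]
        rintro (h | h)
        · exact hb.1 h
        · exact hb.2 (Fin.ext h)
  have h0 : (0 : Fin (K + 1)) = evenHeight hK ⟨0, hL⟩ := Fin.ext (by simp [evenHeight])
  rw [evenTopCount_eq_zpow hK, show (2 * -(L : ℤ) + K) = -1 by omega, h0]
  exact key (L - 1) (by omega) _ (by simp)

/-! ### Shift invariance of the window determinants -/

/-- Conditioning on the height after `K - 2 * i` steps, which is odd. -/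
theorem evenTopCount_sub {K L : ℕ} (hK : K + 1 = 2 * L) (t : ℤ) (i : Fin L) :
    evenTopCount K (t - (i : ℕ)) = ∑ a, (stepMatrix K ^ (K - 2 * (i : ℕ))) 0 (oddHeight hK a) *
      (stepMatrix K ^ (2 * t)) (oddHeight hK a) (Fin.last K) := by
  rw [evenTopCount_eq_zpow hK,
    show (2 * (t - ((i : ℕ) : ℤ)) + K) = ((K - 2 * (i : ℕ) : ℕ) : ℤ) + 2 * t by omega,
    Matrix.zpow_add (isUnit_det_stepMatrix hK), zpow_natCast, Matrix.mul_apply,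
    sum_eq_even_add_odd hK]
  refine add_eq_right.mpr (Finset.sum_eq_zero fun a _ => ?_)
  rw [stepMatrix_pow_apply_eq_zero_of_parity, zero_mul]
  rw [Nat.odd_iff]
  simp only [evenHeight, Fin.val_zero]
  omega

theorem det_window_shift_one {K L : ℕ} (hK : K + 1 = 2 * L) {ι : Type*} [Fintype ι]
    [DecidableEq ι] (e : ι ≃ Fin L) (τ : ι → ℤ) :
    (Matrix.of fun i j => evenTopCount K (τ j + 1 - (e i : ℕ))).det =
      (Matrix.of fun i j => evenTopCount K (τ j - (e i : ℕ))).det := by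
  let P : Matrix ι ι ℚ := Matrix.of fun i a =>
    (stepMatrix K ^ (K - 2 * (e i : ℕ))) 0 (oddHeight hK (e a))
  let U : Matrix ι ι ℚ := Matrix.of fun a j =>
    (stepMatrix K ^ (2 * τ j)) (oddHeight hK (e a)) (Fin.last K)
  let S : Matrix ι ι ℚ := (oddEvenBlock hK * evenOddBlock hK).submatrix e e
  have hS : S.det = 1 := by
    rw [Matrix.det_submatrix_equiv_self, Matrix.det_mul, det_oddEvenBlock, det_evenOddBlock,
      one_mul]
  have h1 : (Matrix.of fun i j => evenTopCount K (τ j - (e i : ℕ))) = P * U := by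
    ext i j
    rw [Matrix.of_apply, evenTopCount_sub hK, Matrix.mul_apply, ← e.sum_comp]
    rfl
  have h2 : (Matrix.of fun i j => evenTopCount K (τ j + 1 - (e i : ℕ))) = P * (S * U) := by
    ext i j
    rw [Matrix.of_apply, evenTopCount_sub hK, Matrix.mul_apply, ← e.sum_comp]
    refine Finset.sum_congr rfl fun a _ => congrArg _ ?_
    rw [mul_add, mul_one, stepMatrix_zpow_add_two_odd, ← e.sum_comp]
    rfl
  rw [h1, h2, Matrix.det_mul, Matrix.det_mul, Matrix.det_mul, hS, one_mul]

theorem det_window_shift {K L : ℕ} (hK : K + 1 = 2 * L) {ι : Type*} [Fintype ι]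
    [DecidableEq ι] (e : ι ≃ Fin L) (τ : ι → ℤ) (p : ℕ) :
    (Matrix.of fun i j => evenTopCount K (τ j + p - (e i : ℕ))).det =
      (Matrix.of fun i j => evenTopCount K (τ j - (e i : ℕ))).det := by
  induction p with
  | zero => simp
  | succ p ih =>
    rw [← ih, ← det_window_shift_one hK e fun j => τ j + p]
    simp only [Nat.cast_succ, add_assoc]

/-! ### Toeplitz minors -/

theorem det_toeplitz_zero {K L : ℕ} (hK : K + 1 = 2 * L) {q : ℕ} (hq : q ≤ L) :
    (Matrix.of fun i j : Fin q => evenTopCount K ((j : ℕ) - (i : ℕ))).det = 1 := by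
  rw [Matrix.det_of_isUpperTriangular]
  · refine Finset.prod_eq_one fun a _ => ?_
    rw [Matrix.of_apply, sub_self, evenTopCount_zero hK]
  · intro a b (hab : b < a)
    exact evenTopCount_eq_zero hK (by omega) (by omega)

theorem det_toeplitz_neg {K L : ℕ} (hK : K + 1 = 2 * L) {q : ℕ} (hq : q ≤ L) :
    (Matrix.of fun i j : Fin q => evenTopCount K (-L + (j : ℕ) - (i : ℕ))).det =
      ((-1) ^ (L - 1)) ^ q := by
  rw [Matrix.det_of_isLowerTriangular]
  · simp [evenTopCount_neg hK]
  · intro a b (hab : a < b)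
    exact evenTopCount_eq_zero hK (by omega) (by omega)

/-- The two block triangular expansions of one window determinant. The constant `c` collects the
diagonal entries of the triangular blocks and the sign of a permutation of the rows. -/
theorem exists_det_toeplitz_eq_mul (K k m : ℕ) (hK : K + 1 = 2 * (k + m)) :
    ∃ c : ℚ, ∀ n : ℕ,
      (Matrix.of fun i j : Fin k => evenTopCount K (n + (j : ℕ) - (i : ℕ))).det *
          ((-1) ^ (k + m - 1)) ^ m =
        c * (Matrix.of fun i j : Fin m =>
          evenTopCount K (-(n : ℤ) - (k + m : ℕ) + (j : ℕ) - (i : ℕ))).det := by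
  let e : Fin k ⊕ Fin m ≃ Fin (k + m) := finSumFinEquiv
  let e' : Fin k ⊕ Fin m ≃ Fin (k + m) :=
    (Equiv.sumComm _ _).trans (finSumFinEquiv.trans (finCongr (add_comm m k)))
  let σ : Equiv.Perm (Fin k ⊕ Fin m) := e.trans e'.symm
  refine ⟨(Equiv.Perm.sign σ : ℤ) * ((-1) ^ (k + m - 1)) ^ k, fun n => ?_⟩
  let τ : Fin k ⊕ Fin m → ℤ := Sum.elim (fun j => (j : ℕ) - (k : ℤ))
    fun j => -(n : ℤ) - (k + m : ℕ) + (j : ℕ)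
  have h1 : (Matrix.of fun i j => evenTopCount K (τ j + (n + k : ℕ) - (e i : ℕ))).det =
      (Matrix.of fun i j : Fin k => evenTopCount K (n + (j : ℕ) - (i : ℕ))).det *
          ((-1) ^ (k + m - 1)) ^ m := by
    rw [← det_toeplitz_neg hK (q := m) (by omega), ← Matrix.det_fromBlocks_zero₁₂ _
      (Matrix.of fun (i : Fin m) (j : Fin k) => evenTopCount K (n + (j : ℕ) - (k + (i : ℕ) : ℕ)))]
    congr 1
    ext (i | i) (j | j)
    · simp only [e, τ, Matrix.of_apply, Matrix.fromBlocks_apply₁₁, Sum.elim_inl,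
        finSumFinEquiv_apply_left, Fin.val_castAdd]
      congr 1
      omega
    · simp only [e, τ, Matrix.of_apply, Matrix.fromBlocks_apply₁₂, Sum.elim_inr,
        finSumFinEquiv_apply_left, Fin.val_castAdd, Matrix.zero_apply]
      exact evenTopCount_eq_zero hK (by omega) (by omega)
    · simp only [e, τ, Matrix.of_apply, Matrix.fromBlocks_apply₂₁, Sum.elim_inl,
        finSumFinEquiv_apply_right, Fin.val_natAdd]
      congr 1
      omega
    · simp only [e, τ, Matrix.of_apply, Matrix.fromBlocks_apply₂₂, Sum.elim_inr,
        finSumFinEquiv_apply_right, Fin.val_natAdd]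
      congr 1
      omega
  have h2 : (Matrix.of fun i j => evenTopCount K (τ j - (e' i : ℕ))).det =
      ((-1) ^ (k + m - 1)) ^ k * (Matrix.of fun i j : Fin m =>
          evenTopCount K (-(n : ℤ) - (k + m : ℕ) + (j : ℕ) - (i : ℕ))).det := by
    rw [← det_toeplitz_neg hK (q := k) (by omega), ← Matrix.det_fromBlocks_zero₂₁ _
      (Matrix.of fun (i : Fin k) (j : Fin m) =>
        evenTopCount K (-(n : ℤ) - (k + m : ℕ) + (j : ℕ) - (m + (i : ℕ) : ℕ)))]
    congr 1
    ext (i | i) (j | j)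
    · simp only [e', τ, Matrix.of_apply, Matrix.fromBlocks_apply₁₁, Sum.elim_inl,
        Equiv.trans_apply, Equiv.sumComm_apply, Sum.swap_inl, finSumFinEquiv_apply_right,
        finCongr_apply, Fin.val_cast, Fin.val_natAdd]
      congr 1
      omega
    · simp only [e', τ, Matrix.of_apply, Matrix.fromBlocks_apply₁₂, Sum.elim_inr,
        Equiv.trans_apply, Equiv.sumComm_apply, Sum.swap_inl, finSumFinEquiv_apply_right,
        finCongr_apply, Fin.val_cast, Fin.val_natAdd]
    · simp only [e', τ, Matrix.of_apply, Matrix.fromBlocks_apply₂₁, Sum.elim_inl,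
        Equiv.trans_apply, Equiv.sumComm_apply, Sum.swap_inr, finSumFinEquiv_apply_left,
        finCongr_apply, Fin.val_cast, Fin.val_castAdd, Matrix.zero_apply]
      exact evenTopCount_eq_zero hK (by omega) (by omega)
    · simp only [e', τ, Matrix.of_apply, Matrix.fromBlocks_apply₂₂, Sum.elim_inr,
        Equiv.trans_apply, Equiv.sumComm_apply, Sum.swap_inr, finSumFinEquiv_apply_left,
        finCongr_apply, Fin.val_cast, Fin.val_castAdd]
  have h3 : (Matrix.of fun i j => evenTopCount K (τ j - (e i : ℕ))).det =
      (Equiv.Perm.sign σ : ℤ) * (Matrix.of fun i j => evenTopCount K (τ j - (e' i : ℕ))).det := by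
    rw [← Matrix.det_permute]
    congr 1
    ext i j
    simp [σ]
  rw [← h1, det_window_shift hK, h3, h2, mul_assoc]

theorem det_toeplitz_eq (K k m n : ℕ) (hK : K + 1 = 2 * (k + m)) :
    (Matrix.of fun i j : Fin k => evenTopCount K (n + (j : ℕ) - (i : ℕ))).det =
      (-1) ^ (k * m) * (Matrix.of fun i j : Fin m =>
        evenTopCount K (-(n : ℤ) - (k + m : ℕ) + (j : ℕ) - (i : ℕ))).det := by
  obtain ⟨c, hc⟩ := exists_det_toeplitz_eq_mul K k m hK
  have hsign : (((-1) ^ (k + m - 1)) ^ m : ℚ) = (-1) ^ (k * m) := by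
    rw [← pow_mul]
    rcases Nat.eq_zero_or_pos m with rfl | hm
    · simp
    -- The exponents differ by `(m - 1) * m`, which is even.
    obtain ⟨q, rfl⟩ : ∃ q, m = q + 1 := ⟨m - 1, by omega⟩
    rw [show k + (q + 1) - 1 = k + q by omega, add_mul, pow_add,
      (Nat.even_mul_succ_self q).neg_one_pow, mul_one]
  have hsq : ((-1) ^ (k * m) * (-1) ^ (k * m) : ℚ) = 1 := by
    rw [← mul_pow]
    simp
  have h0 := hc 0
  simp only [Nat.cast_zero, zero_add, neg_zero, zero_sub] at h0
  rw [det_toeplitz_zero hK (by omega), det_toeplitz_neg hK (by omega), hsign] at h0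
  have hc1 : c = 1 := by linear_combination (-(-1) ^ (k * m) : ℚ) * h0 + (1 - c) * hsq
  have hn := hc n
  rw [hc1, hsign, one_mul] at hn
  rw [← hn, mul_comm, mul_assoc, hsq, mul_one]

theorem theorem18 (n k m : ℕ) (hk : 0 < k) (hm : 0 < m) :
    Matrix.det (Matrix.of fun i j : Fin k =>
        topPathCount (2 * k + 2 * m - 1)
          (2 * (n : ℤ) + 2 * ((j : ℕ) : ℤ) - 2 * ((i : ℕ) : ℤ))) =
      (-1) ^ (k * m) *
        Matrix.det (Matrix.of fun i j : Fin m =>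
          topPathCount (2 * k + 2 * m - 1)
            (-2 * (n : ℤ) - 2 * ((j : ℕ) : ℤ) + 2 * ((i : ℕ) : ℤ)
              - 2 * (k : ℤ) - 2 * (m : ℤ))) := by
  have h := det_toeplitz_eq (2 * k + 2 * m - 1) k m n (by omega)
  -- The minor on the right is the transpose of the one in `det_toeplitz_eq`.
  rw [← Matrix.det_transpose (Matrix.of fun i j : Fin m => evenTopCount _ _)] at h
  convert h using 3
  · ext i j
    simp only [evenTopCount]
    congr 1
    ring
  · congr 1
    ext i j
    simp only [Matrix.of_apply, evenTopCount]
    congr 1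
    push_cast
    ring
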